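/- Write $X=\mathbb{R}^2/\mathbb{Z}^2$ with projection $\pi:\mathbb{R}^2\to X$, and let $2^X$ be the space of nonempty compact subsets of $X$ with the Hausdorff (equivalently, Vietoris) topology. A continuous map $f:X\to X$ induces $f_*:2^X\to 2^X$, $f_*(A)=f(A)$. A point $x$ is a transitive point of a map if its omega limit set (the set of limit points of its forward orbit sequence) is the whole space. A Cantor set is a nonempty, perfect, compact, zero-dimensional metrizable space. A Kronecker set for $f$ is a Cantor set $L\subset X$ such that $\{f^n|_L : n\in\mathbb{N}\}$ is dense in the space $\mathcal{C}(L,X)$ of continuous maps with the topology of uniform convergence. **Theorem 4.3.** Let $A$ be a $2\times 2$ integer matrix with $\det A=\pm1$ and no complex eigenvalue of modulus $1$, for example $A=\begin{pmatrix}3&1\\5&2\end{pmatrix}$, and let $t:X\to X$ be the hyperbolic toral automorphism induced by $A$. Then there exist a transitive point $C\in 2^X$ of $t_*$ and a Cantor set $L\subset X$ such that $C$ is homeomorphic to $L\times[0,1]$, and every connected component of $C$ is homeomorphic to $[0,1]$. Moreover $C$ and $L$ can be chosen so that $C$ is obtained by thickening a Kronecker set along stable lines: $L$ is a Kronecker set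 for $t$, and there are a unit vector $v\in\mathbb{R}^2$, a real $\mu$ with $|\mu|<1$ and $Av=\mu v$, and $M>0$, such that $(a,s)\mapsto a+\pi(sv)$ is a homeomorphism from $L\times[-M,M]$ onto $C$. -/

import Mathlib

open Set Filter Topology TopologicalSpace

/-- A point `x` is a transitive point of `f` when its omega limit set (the set of limit points of
the orbit sequence `f^n x`) is the whole space. -/
def IsTransitivePoint {X : Type*} [TopologicalSpace X] (f : X → X) (x : X) : Prop :=
  omegaLimit atTop (fun n : ℕ => f^[n]) {x} = univ

/-- The induced map `A ↦ f(A)` on the space `2^X` of nonempty compact subsets of `X`. -/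
def inducedMap {X : Type*} [TopologicalSpace X] (f : C(X, X)) :
    NonemptyCompacts X → NonemptyCompacts X :=
  NonemptyCompacts.map f f.continuous

/-- A Cantor set in a metrizable space: nonempty, compact, without isolated points, and
zero-dimensional (for compact Hausdorff sets this means totally disconnected). -/
def IsCantorSet {X : Type*} [TopologicalSpace X] (L : Set X) : Prop :=
  L.Nonempty ∧ IsCompact L ∧ Preperfect L ∧ IsTotallyDisconnected L

/-- The restriction of the `n`-th iterate of `f` to a subset `L`, as an element of `C(L, X)`. -/
def iterateRestrict {X : Type*} [TopologicalSpace X] (f : C(X, X)) (L : Set X) (n : ℕ) :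
    C(L, X) :=
  ⟨fun x => f^[n] (x : X), (f.continuous.iterate n).comp continuous_subtype_val⟩

/-- A Kronecker set for `(X, f)`: a Cantor set `L` in `X` such that the restrictions to `L` of the
iterates of `f` are dense in `C(L, X)`. The topology of `C(L, X)` is the compact-open one, which is
that of uniform convergence since `L` is compact. -/
def IsKroneckerSet {X : Type*} [TopologicalSpace X] (f : C(X, X)) (L : Set X) : Prop :=
  IsCantorSet L ∧ Dense (range (iterateRestrict f L))

/-- The canonical projection from `ℝ²` to `ℝ² / ℤ²`. -/
def torusProj (x : EuclideanSpace ℝ (Fin 2)) : UnitAddTorus (Fin 2) :=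
  fun i => ((x i : ℝ) : UnitAddCircle)

/-- The map of `ℝ² / ℤ²` induced by an integer matrix. -/
def toralMap (A : Matrix (Fin 2) (Fin 2) ℤ) : C(UnitAddTorus (Fin 2), UnitAddTorus (Fin 2)) where
  toFun x i := ∑ j, A i j • x j
  continuous_toFun := by fun_prop

/-- The linear map of `ℝ²` given by an integer matrix. -/
def planeMap (A : Matrix (Fin 2) (Fin 2) ℤ) (x : EuclideanSpace ℝ (Fin 2)) :
    EuclideanSpace ℝ (Fin 2) :=
  WithLp.toLp 2 ((A.map (Int.cast : ℤ → ℝ)).mulVec x.ofLp)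

/-- The torus map is the one induced by the linear map. -/
theorem toralMap_torusProj (A : Matrix (Fin 2) (Fin 2) ℤ) (x : EuclideanSpace ℝ (Fin 2)) :
    toralMap A (torusProj x) = torusProj (planeMap A x) := by
  funext i
  simp only [toralMap, torusProj, planeMap, Matrix.mulVec, dotProduct, Fin.sum_univ_two,
    ContinuousMap.coe_mk, Matrix.map_apply, ← AddCircle.coe_zsmul, zsmul_eq_mul, AddCircle.coe_add]

/-- An integer matrix that induces a hyperbolic automorphism of the torus: it is
invertible over `ℤ` and has no complex eigenvalue of modulus one. -/
def IsHyperbolicToral (A : Matrix (Fin 2) (Fin 2) ℤ) : Prop :=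
  IsUnit A.det ∧ ∀ z ∈ spectrum ℂ (A.map (Int.cast : ℤ → ℂ)), ‖z‖ ≠ 1

/-- The standard example of a hyperbolic matrix considered here. -/
theorem isHyperbolicToral_example : IsHyperbolicToral !![3, 1; 5, 2] := by
  refine ⟨by simp [Matrix.det_fin_two], fun z hz h1 => ?_⟩
  rw [Matrix.mem_spectrum_iff_isRoot_charpoly, Polynomial.IsRoot.def,
    Matrix.eval_charpoly] at hz
  simp [Matrix.det_fin_two, Matrix.scalar_apply] at hz
  have h : 5 * z = z ^ 2 + 1 := by linear_combination -hz
  have h5 : ‖5 * z‖ = 5 := by simp [h1]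
  have h2 : ‖z ^ 2 + 1‖ ≤ 2 := by
    refine (norm_add_le _ _).trans ?_
    rw [norm_pow, h1]; norm_num
  rw [h] at h5
  linarith

/-! Hyperbolicity gives unit eigenvectors `v`, `w` with real eigenvalues `|μ| < 1 < |b|`. Since `b`
is irrational, the line through `w` winds densely around the torus, so `t^n` stretches every
unstable segment of a fixed length until it is `δ`-dense, uniformly in its centre
(`eventually_expanded_segment_dense`).

A Baire argument in `C(K, ℝ)`, with `K` the Cantor space, then gives a small `h` such that the maps
`x ↦ t^n (π (h x • w))` approximate every continuous map from `K` to the torus infinitely often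
(`exists_forall_approx`). This forces `h` to be injective, so `L = π (h(K) • w)` is a Kronecker set.

Every nonempty compact set is a continuous image of `K`, so the sets `t^n(L)` accumulate at all of
them. Thickening `L` along `v` changes no limit, because `t^n` contracts stable segments by `|μ|^n`
(`isTransitivePoint_inducedMap`); with short segments the thickening is an embedded product. -/

/-! ### Eigenvalues, eigenvectors and irrationality -/

theorem planeMap_smul (A : Matrix (Fin 2) (Fin 2) ℤ) (c : ℝ) (x : EuclideanSpace ℝ (Fin 2)) :
    planeMap A (c • x) = c • planeMap A x := by
  ext i
  fin_cases i <;> simp [planeMap] <;> ring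

theorem planeMap_add (A : Matrix (Fin 2) (Fin 2) ℤ) (x y : EuclideanSpace ℝ (Fin 2)) :
    planeMap A (x + y) = planeMap A x + planeMap A y := by
  ext i
  fin_cases i <;> simp [planeMap] <;> ring

theorem planeMap_apply_zero (A : Matrix (Fin 2) (Fin 2) ℤ) (x : EuclideanSpace ℝ (Fin 2)) :
    planeMap A x 0 = A 0 0 * x 0 + A 0 1 * x 1 := by
  simp [planeMap]

theorem planeMap_apply_one (A : Matrix (Fin 2) (Fin 2) ℤ) (x : EuclideanSpace ℝ (Fin 2)) :
    planeMap A x 1 = A 1 0 * x 0 + A 1 1 * x 1 := by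
  simp [planeMap]

/-- The characteristic equation of a `2 × 2` matrix over `ℂ` cuts out its spectrum. -/
theorem mem_spectrum_of_charpoly_eq_zero (A : Matrix (Fin 2) (Fin 2) ℤ) (z : ℂ)
    (hz : z ^ 2 - A.trace * z + A.det = 0) :
    z ∈ spectrum ℂ (A.map (Int.cast : ℤ → ℂ)) := by
  rw [Matrix.mem_spectrum_iff_isRoot_charpoly, Polynomial.IsRoot.def, Matrix.eval_charpoly]
  simp only [Matrix.det_fin_two, Matrix.trace_fin_two, Matrix.scalar_apply] at hz ⊢
  simp
  push_cast at hz
  linear_combination hz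

theorem exists_eigenvector (A : Matrix (Fin 2) (Fin 2) ℤ) (c : ℝ)
    (hc : c ^ 2 - A.trace * c + A.det = 0) :
    ∃ v : EuclideanSpace ℝ (Fin 2), ‖v‖ = 1 ∧ planeMap A v = c • v := by
  have hdet : (A.map (Int.cast : ℤ → ℝ) - Matrix.scalar (Fin 2) c).det = 0 := by
    simp only [Matrix.det_fin_two, Matrix.trace_fin_two, Matrix.scalar_apply] at hc ⊢
    simp
    push_cast at hc
    linear_combination hc
  obtain ⟨x, hx0, hx⟩ := Matrix.exists_mulVec_eq_zero_iff.2 hdet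
  have hne : WithLp.toLp 2 x ≠ 0 := by simpa using hx0
  have heig : planeMap A (WithLp.toLp 2 x) = c • WithLp.toLp 2 x := by
    rw [Matrix.sub_mulVec, sub_eq_zero] at hx
    ext i
    have := congrFun hx i
    simpa [planeMap, Matrix.scalar_apply, Matrix.mulVec_diagonal] using this
  refine ⟨‖WithLp.toLp 2 x‖⁻¹ • WithLp.toLp 2 x, ?_, ?_⟩
  · rw [norm_smul, norm_inv, norm_norm, inv_mul_cancel₀ (norm_ne_zero_iff.2 hne)]
  · rw [planeMap_smul, heig, smul_comm]

/-- A hyperbolic matrix has a contracting and an expanding real eigenvalue. -/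
theorem IsHyperbolicToral.exists_eigenvalues {A : Matrix (Fin 2) (Fin 2) ℤ}
    (hA : IsHyperbolicToral A) : ∃ a b : ℝ, |a| < 1 ∧ 1 < |b| ∧
      a ^ 2 - A.trace * a + A.det = 0 ∧ b ^ 2 - A.trace * b + A.det = 0 := by
  obtain ⟨hdet, hspec⟩ := hA
  have hroot (r : ℝ) (hr : r ^ 2 - A.trace * r + A.det = 0) : |r| ≠ 1 := by
    have hr' := congrArg (Complex.ofReal) hr
    push_cast [-Int.cast_det] at hr'
    have := hspec (r : ℂ) (mem_spectrum_of_charpoly_eq_zero A r hr')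
    simpa using this
  have hd : (A.det : ℝ) = 1 ∨ (A.det : ℝ) = -1 := by
    rcases Int.isUnit_iff.1 hdet with h | h <;> simp [h]
  -- A negative discriminant forces determinant `1` and two conjugate roots; their product is `1`,
  -- so they lie on the unit circle.
  have hdisc : 0 ≤ (A.trace : ℝ) ^ 2 - 4 * A.det := by
    by_contra! hneg
    rcases hd with hd | hd
    · set s := √(4 * A.det - (A.trace : ℝ) ^ 2) with hs
      have hs2 : s ^ 2 = 4 * A.det - (A.trace : ℝ) ^ 2 := Real.sq_sqrt (by linarith)
      have hz := mem_spectrum_of_charpoly_eq_zero A (⟨A.trace / 2, s / 2⟩ : ℂ) (by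
        apply Complex.ext
        · simp [pow_two]
          nlinarith
        · simp [pow_two]
          ring)
      apply hspec _ hz
      rw [Complex.norm_def, Complex.normSq_mk, Real.sqrt_eq_one]
      rw [hd] at hs2
      nlinarith
    · nlinarith [sq_nonneg (A.trace : ℝ)]
  set s := √((A.trace : ℝ) ^ 2 - 4 * A.det) with hs
  have hs2 : s ^ 2 = (A.trace : ℝ) ^ 2 - 4 * A.det := Real.sq_sqrt hdisc
  have ha : ((A.trace - s) / 2) ^ 2 - A.trace * ((A.trace - s) / 2) + A.det = 0 := by
    linear_combination hs2 / 4
  have hb : ((A.trace + s) / 2) ^ 2 - A.trace * ((A.trace + s) / 2) + A.det = 0 := by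
    linear_combination hs2 / 4
  have hab : |(A.trace - s) / 2| * |(A.trace + s) / 2| = 1 := by
    rw [← abs_mul, show (A.trace - s) / 2 * ((A.trace + s) / 2) = (A.det : ℝ) by
      linear_combination - hs2 / 4]
    rcases hd with hd | hd <;> simp [hd]
  rcases lt_or_gt_of_ne (hroot _ ha) with h | h
  · refine ⟨_, _, h, ?_, ha, hb⟩
    by_contra! h'
    nlinarith [abs_nonneg ((A.trace - s) / 2), abs_nonneg ((A.trace + s) / 2)]
  · refine ⟨_, _, ?_, h, hb, ha⟩
    by_contra! h'
    nlinarith [abs_nonneg ((A.trace - s) / 2), abs_nonneg ((A.trace + s) / 2)]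

/-- A rational root of `X² - t X + d` with `d = ±1` is `±1`. -/
theorem irrational_of_quadratic {t d : ℤ} (hd : IsUnit d) {b : ℝ} (hb : 1 < |b|)
    (h : b ^ 2 - t * b + d = 0) : Irrational b := by
  rintro ⟨q, rfl⟩
  have hq : q ^ 2 - t * q + d = 0 := by exact_mod_cast h
  have hint : IsIntegral ℤ q := by
    refine ⟨Polynomial.X ^ 2 - Polynomial.C t * Polynomial.X + Polynomial.C d, ?_, ?_⟩
    · monicity!
    · rw [Polynomial.eval₂_add, Polynomial.eval₂_sub, Polynomial.eval₂_mul, Polynomial.eval₂_C,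
        Polynomial.eval₂_C, Polynomial.eval₂_X_pow, Polynomial.eval₂_X]
      exact hq
  obtain ⟨m, rfl⟩ := IsIntegrallyClosed.isIntegral_iff.1 hint
  -- The root is an integer by integral closedness, and it divides the unit `d`.
  have hm : m * (t - m) = d := by
    have : (m : ℚ) ^ 2 - t * m + d = 0 := by simpa using hq
    have : m ^ 2 - t * m + d = 0 := by exact_mod_cast this
    linarith
  have : IsUnit m := isUnit_of_mul_isUnit_left (hm ▸ hd)
  rcases Int.isUnit_iff.1 this with rfl | rfl <;> simp at hb

/-- An eigenline with irrational eigenvalue has irrational slope. -/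
theorem irrational_slope {A : Matrix (Fin 2) (Fin 2) ℤ} {b : ℝ} (hb : Irrational b)
    {w : EuclideanSpace ℝ (Fin 2)} (hw : w ≠ 0) (h : planeMap A w = b • w) :
    w 0 ≠ 0 ∧ Irrational (w 1 / w 0) := by
  have h0 : A 0 0 * w 0 + A 0 1 * w 1 = b * w 0 := by
    rw [← planeMap_apply_zero, h]; rfl
  have h1 : A 1 0 * w 0 + A 1 1 * w 1 = b * w 1 := by
    rw [← planeMap_apply_one, h]; rfl
  have hw0 : w 0 ≠ 0 := by
    intro hz
    have hw1 : w 1 ≠ 0 := by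
      intro hz1
      apply hw
      ext i
      fin_cases i <;> simp [hz, hz1]
    rw [hz, mul_zero, zero_add] at h1
    exact hb ⟨A 1 1, by simpa using mul_right_cancel₀ hw1 h1⟩
  refine ⟨hw0, ?_⟩
  rintro ⟨q, hq⟩
  have hw1 : w 1 = q * w 0 := by rw [hq]; field_simp
  refine hb ⟨A 0 0 + A 0 1 * q, mul_right_cancel₀ hw0 ?_⟩
  rw [← h0, hw1]
  push_cast
  ring

/-! ### Baire category argument -/

/-- Suppose that the curves `F n` are, for `n` large, `δ`-dense on every interval of length `2 ε`.
Then for some (in fact a generic) family of parameters indexed by a profinite space, the curves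
approximate every continuous map infinitely often. -/
theorem exists_forall_approx {K X : Type*} [TopologicalSpace K] [CompactSpace K] [T2Space K]
    [TotallyDisconnectedSpace K] [SecondCountableTopology K]
    [MetricSpace X] [CompactSpace X] (F : ℕ → C(ℝ, X))
    (hF : ∀ ε > 0, ∀ δ > 0, ∃ N, ∀ n ≥ N, ∀ a : ℝ, ∀ y : X, ∃ c, |c - a| < ε ∧ dist (F n c) y < δ)
    {r : ℝ} (hr : 0 < r) :
    ∃ h : C(K, ℝ), (∀ x, |h x| < r) ∧ ∀ (g : C(K, X)) (ε : ℝ), 0 < ε → ∀ N, ∃ n ≥ N,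
      ∀ x, dist (F n (h x)) (g x) < ε := by
  rcases isEmpty_or_nonempty X with hX | hX
  · exact ⟨0, fun _ => by simpa using hr, fun g ε hε N => ⟨N, le_rfl, fun x => (hX.false (g x)).elim⟩⟩
  have : Nonempty C(K, X) := ⟨ContinuousMap.const _ hX.some⟩
  -- For `i = (j, m, N)`: some `F n ∘ h` with `n ≥ N` is within `1 / (m + 1)` of the `j`-th term of
  -- a dense sequence in `C(K, X)`.
  let U (i : ℕ × ℕ × ℕ) : Set C(K, ℝ) :=
    ⋃ n ≥ i.2.2, (fun h : C(K, ℝ) => (F n).comp h) ⁻¹'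
      Metric.ball (denseSeq C(K, X) i.1) (1 / (i.2.1 + 1))
  have hopen i : IsOpen (U i) := isOpen_biUnion fun n _ =>
    Metric.isOpen_ball.preimage (ContinuousMap.continuous_postcomp (F n))
  have hdense i : Dense (U i) := by
    obtain ⟨j, m, N⟩ := i
    rw [Metric.dense_iff]
    intro h₀ ε hε
    have hδ : (0 : ℝ) < 1 / (m + 1) := by positivity
    obtain ⟨N', hN'⟩ := hF (ε / 4) (by positivity) (1 / (m + 1) / 4) (by positivity)
    -- The pair (`h₀`, target) is approximated by a map through a finite discrete space. On each
    -- piece a constant near `h₀` can be chosen that `F n` sends near the target.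
    obtain ⟨k, p, q, hp, hpq⟩ := ContinuousMap.exists_finite_approximation_of_mem_nhds_diagonal
      (S := {x : (ℝ × X) × (ℝ × X) | dist x.1 x.2 < min (ε / 4) (1 / (m + 1) / 4)})
      (h₀.prodMk (denseSeq C(K, X) j)) (by
        rw [mem_nhdsSet_iff_forall]
        rintro ⟨x, y⟩ (rfl : x = y)
        exact (isOpen_lt continuous_dist continuous_const).mem_nhds (by
          rw [mem_ofPred_eq, dist_self]; positivity))
    choose c hc using fun i => hN' (max N N') (le_max_right _ _) (q i).1 (q i).2
    refine ⟨⟨fun x => c (p x), (continuous_of_discreteTopology (f := c)).comp hp⟩, ?_, ?_⟩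
    · rw [Metric.mem_ball]
      refine lt_of_le_of_lt ((ContinuousMap.dist_le (C := ε / 2) (by positivity)).2 fun x => ?_)
        (by linarith)
      have h1 := (hc (p x)).1
      have h2 : dist (h₀ x) (q (p x)).1 < ε / 4 :=
        (le_max_left _ _).trans_lt ((hpq x).trans_le (min_le_left _ _))
      rw [← Real.dist_eq] at h1
      have := dist_triangle_right (c (p x)) (h₀ x) (q (p x)).1
      simp only [ContinuousMap.coe_mk]
      linarith
    · simp only [U, mem_iUnion]
      refine ⟨max N N', le_max_left _ _, ?_⟩
      rw [mem_preimage, Metric.mem_ball]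
      refine lt_of_le_of_lt
        ((ContinuousMap.dist_le (C := 1 / (m + 1) / 2) (by positivity)).2 fun x => ?_)
        (by linarith)
      have h1 := (hc (p x)).2
      have h2 : dist (denseSeq C(K, X) j x) (q (p x)).2 < 1 / (m + 1) / 4 :=
        (le_max_right _ _).trans_lt ((hpq x).trans_le (min_le_right _ _))
      have := dist_triangle_right (F (max N N') (c (p x))) (denseSeq C(K, X) j x) (q (p x)).2
      simp only [ContinuousMap.comp_apply, ContinuousMap.coe_mk]
      linarith
  obtain ⟨h, hhr, hh⟩ := (dense_iInter_of_isOpen hopen hdense).exists_mem_open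
    Metric.isOpen_ball ⟨0, Metric.mem_ball_self hr⟩
  refine ⟨h, fun x => ?_, fun g ε hε N => ?_⟩
  · rw [Metric.mem_ball, dist_zero_right] at hh
    exact (h.norm_coe_le_norm x).trans_lt hh
  · obtain ⟨m, hm⟩ := exists_nat_one_div_lt (half_pos hε)
    obtain ⟨j, hj⟩ := (denseRange_denseSeq C(K, X)).exists_dist_lt g (half_pos hε)
    obtain ⟨n, hn, hd⟩ := mem_iUnion₂.1 (mem_iInter.1 hhr (j, m, N))
    refine ⟨n, hn, fun x => ?_⟩
    rw [mem_preimage, Metric.mem_ball] at hd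
    calc dist (F n (h x)) (g x) ≤ dist ((F n).comp h) g :=
          ContinuousMap.dist_apply_le_dist (f := (F n).comp h) (g := g) x
      _ ≤ dist ((F n).comp h) (denseSeq C(K, X) j) + dist g (denseSeq C(K, X) j) :=
          dist_triangle_right _ _ _
      _ < ε := by simp only at hd; linarith

/-! ### The Cantor space -/

/-- The Cantor space has no isolated points. -/
instance cantorSpace_perfectSpace : PerfectSpace (ℕ → Bool) := by
  rw [perfectSpace_iff_forall_not_isolated]
  intro x
  -- Flipping the `n`-th coordinate gives points distinct from `x` that converge to `x`.
  have ht : Tendsto (fun n => Function.update x n (!x n)) atTop (𝓝[≠] x) := by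
    refine tendsto_nhdsWithin_iff.2 ⟨?_, Eventually.of_forall fun n hn => ?_⟩
    · rw [tendsto_pi_nhds]
      intro i
      refine tendsto_const_nhds.congr' ?_
      filter_upwards [eventually_gt_atTop i] with n hn
      rw [Function.update_of_ne hn.ne]
    · simpa using congrFun hn n
  exact ht.neBot

/-- An embedded copy of the Cantor space is a Cantor set. -/
theorem isCantorSet_range {X : Type*} [TopologicalSpace X] {e : (ℕ → Bool) → X}
    (he : IsEmbedding e) : IsCantorSet (range e) := by
  refine ⟨range_nonempty e, isCompact_range he.continuous, ?_, ?_⟩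
  · rintro _ ⟨x, rfl⟩
    have h : AccPt x (𝓟 univ) := PerfectSpace.univ_preperfect x (mem_univ x)
    rw [accPt_iff_frequently] at h ⊢
    refine (he.continuous.tendsto x).frequently (h.mono fun y hy => ?_)
    exact ⟨he.injective.ne hy.1, mem_range_self y⟩
  · rw [← image_univ]
    exact he.isTotallyDisconnected_image.2 (isTotallyDisconnected_of_totallyDisconnectedSpace _)

/-! ### The torus projection and iterates on eigenlines -/

theorem continuous_torusProj : Continuous torusProj := by
  unfold torusProj
  fun_prop

theorem torusProj_add (x y : EuclideanSpace ℝ (Fin 2)) :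
    torusProj (x + y) = torusProj x + torusProj y := by
  ext i
  simp [torusProj]

theorem torusProj_sub (x y : EuclideanSpace ℝ (Fin 2)) :
    torusProj (x - y) = torusProj x - torusProj y := by
  ext i
  simp [torusProj]

theorem norm_torusProj_le (x : EuclideanSpace ℝ (Fin 2)) : ‖torusProj x‖ ≤ ‖x‖ := by
  refine (pi_norm_le_iff_of_nonneg (norm_nonneg x)).2 fun i => ?_
  refine le_trans ?_ (PiLp.norm_apply_le x i)
  exact QuotientAddGroup.norm_mk_le_norm

/-- An integer of absolute value below `1` is zero. Hence the projection is injective on sets of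
diameter less than `1`. -/
theorem eq_zero_of_torusProj_eq_zero {x : EuclideanSpace ℝ (Fin 2)} (hx : ‖x‖ < 1)
    (h : torusProj x = 0) : x = 0 := by
  ext i
  obtain ⟨n, hn⟩ := AddCircle.coe_eq_zero_iff (p := (1 : ℝ)) |>.1 (congrFun h i)
  have h1 : |x i| < 1 := (PiLp.norm_apply_le x i).trans_lt hx
  have hn' : (n : ℝ) = x i := by simpa using hn
  rw [← hn', ← Int.cast_abs, ← Int.cast_one, Int.cast_lt] at h1
  have : n = 0 := Int.abs_lt_one_iff.1 h1
  simp [← hn', this]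

theorem toralMap_add (A : Matrix (Fin 2) (Fin 2) ℤ) (x y : UnitAddTorus (Fin 2)) :
    toralMap A (x + y) = toralMap A x + toralMap A y := by
  ext i
  simp [toralMap]
  abel

theorem iterate_toralMap_add (A : Matrix (Fin 2) (Fin 2) ℤ) (n : ℕ)
    (x y : UnitAddTorus (Fin 2)) :
    (toralMap A)^[n] (x + y) = (toralMap A)^[n] x + (toralMap A)^[n] y := by
  induction n generalizing x y with
  | zero => rfl
  | succ n ih => simp only [Function.iterate_succ_apply, toralMap_add, ih]

theorem iterate_toralMap_torusProj_smul {A : Matrix (Fin 2) (Fin 2) ℤ}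
    {w : EuclideanSpace ℝ (Fin 2)} {b : ℝ} (hw : planeMap A w = b • w) (n : ℕ) (c : ℝ) :
    (toralMap A)^[n] (torusProj (c • w)) = torusProj ((b ^ n * c) • w) := by
  induction n generalizing c with
  | zero => simp
  | succ n ih =>
    rw [Function.iterate_succ_apply, toralMap_torusProj, planeMap_smul, hw, smul_smul, ih]
    ring_nf

/-- Eigenvectors for distinct eigenvalues are linearly independent. -/
theorem eigenvectors_independent {A : Matrix (Fin 2) (Fin 2) ℤ}
    {v w : EuclideanSpace ℝ (Fin 2)} {a b : ℝ} (hab : a ≠ b) (hv0 : v ≠ 0) (hw0 : w ≠ 0)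
    (hv : planeMap A v = a • v) (hw : planeMap A w = b • w) {c d : ℝ}
    (h : c • w + d • v = 0) : c = 0 ∧ d = 0 := by
  have h1 : c • b • w + d • a • v = 0 := by
    rw [← hv, ← hw, ← planeMap_smul, ← planeMap_smul, ← planeMap_add, h]
    simp [planeMap]
  have h2 : (c * (b - a)) • w = 0 := by
    have := congrArg (fun u => a • u) h
    simp only [smul_zero] at this
    rw [← sub_zero (0 : EuclideanSpace ℝ (Fin 2))]
    nth_rewrite 1 [← h1]
    rw [← this]
    module
  have hc : c = 0 := by
    rcases smul_eq_zero.1 h2 with h | h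
    · exact (mul_eq_zero.1 h).resolve_right (sub_ne_zero.2 hab.symm)
    · exact absurd h hw0
  refine ⟨hc, ?_⟩
  rw [hc, zero_smul, zero_add] at h
  exact (smul_eq_zero.1 h).resolve_right hv0

/-! ### Density of the unstable line -/

/-- A line of irrational slope is dense in the torus. -/
theorem denseRange_torusProj_smul {w : EuclideanSpace ℝ (Fin 2)} (hw0 : w 0 ≠ 0)
    (hw : Irrational (w 1 / w 0)) : DenseRange fun s : ℝ => torusProj (s • w) := by
  rw [Metric.denseRange_iff]
  intro y ε hε
  obtain ⟨x, hx⟩ := QuotientAddGroup.mk_surjective (y 0)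
  have hd : DenseRange (· • ((w 1 / w 0 : ℝ) : UnitAddCircle) : ℤ → UnitAddCircle) :=
    AddCircle.denseRange_zsmul_coe_iff.2 (by simpa using hw)
  obtain ⟨k, hk⟩ := (Metric.denseRange_iff.1 hd) (y 1 - ((x * (w 1 / w 0) : ℝ) : UnitAddCircle))
    ε hε
  -- This parameter hits the first coordinate exactly for every integer `k`; the second is then
  -- approximated by an irrational rotation.
  refine ⟨(x + k) / w 0, (dist_pi_lt_iff hε).2 fun i => ?_⟩
  fin_cases i
  · have : torusProj (((x + k) / w 0) • w) 0 = y 0 := by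
      rw [← hx]
      simp only [torusProj, PiLp.smul_apply, smul_eq_mul, div_mul_cancel₀ _ hw0]
      rw [AddCircle.coe_add]
      simp
    simp only [Fin.zero_eta, this, dist_self, hε]
  · have : torusProj (((x + k) / w 0) • w) 1 =
        k • ((w 1 / w 0 : ℝ) : UnitAddCircle) + ((x * (w 1 / w 0) : ℝ) : UnitAddCircle) := by
      simp only [torusProj, PiLp.smul_apply, smul_eq_mul]
      rw [← AddCircle.coe_zsmul, ← AddCircle.coe_add]
      congr 1
      rw [zsmul_eq_mul]
      ring
    simp only [Fin.mk_one, this]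
    rwa [dist_eq_norm, ← sub_sub, sub_right_comm, ← dist_eq_norm]

/-- If a line is dense in the torus, some bounded segment of it is `δ`-dense. -/
theorem exists_segment_dense {w : EuclideanSpace ℝ (Fin 2)}
    (hw : DenseRange fun s : ℝ => torusProj (s • w)) {δ : ℝ} (hδ : 0 < δ) :
    ∃ R : ℝ, ∀ y, ∃ s : ℝ, |s| ≤ R ∧ dist (torusProj (s • w)) y < δ := by
  obtain ⟨t, ht⟩ := isCompact_univ.elim_finite_subcover
    (fun s : ℝ => Metric.ball (torusProj (s • w)) δ) (fun _ => Metric.isOpen_ball) (fun y _ => by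
      obtain ⟨s, hs⟩ := Metric.denseRange_iff.1 hw y δ hδ
      exact mem_iUnion.2 ⟨s, hs⟩)
  refine ⟨∑ s ∈ t, |s|, fun y => ?_⟩
  obtain ⟨s, hs, hy⟩ := mem_iUnion₂.1 (ht (mem_univ y))
  exact ⟨s, Finset.single_le_sum (f := fun s => |s|) (fun _ _ => abs_nonneg _) hs,
    by rw [dist_comm]; exact hy⟩

/-- Expanded segments of a dense line become dense, uniformly in their centre. -/
theorem eventually_expanded_segment_dense {w : EuclideanSpace ℝ (Fin 2)}
    (hw : DenseRange fun s : ℝ => torusProj (s • w)) {b : ℝ} (hb : 1 < |b|) {ε δ : ℝ}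
    (hε : 0 < ε) (hδ : 0 < δ) :
    ∃ N : ℕ, ∀ n ≥ N, ∀ a : ℝ, ∀ y,
      ∃ c, |c - a| < ε ∧ dist (torusProj ((b ^ n * c) • w)) y < δ := by
  obtain ⟨R, hR⟩ := exists_segment_dense hw hδ
  obtain ⟨N, hN⟩ := eventually_atTop.1
    ((tendsto_pow_atTop_atTop_of_one_lt hb).eventually_gt_atTop (R / ε))
  refine ⟨N, fun n hn a y => ?_⟩
  -- The displacement needed after expansion is at most `R`, so before expansion it is at most `R /
  -- |b| ^ n < ε`.
  obtain ⟨s, hs, hy⟩ := hR (y - torusProj ((b ^ n * a) • w))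
  have hb0 : b ^ n ≠ 0 := pow_ne_zero _ fun h => by simp [h] at hb; linarith
  refine ⟨a + s / b ^ n, ?_, ?_⟩
  · rw [add_sub_cancel_left, abs_div, abs_pow, div_lt_iff₀ (by positivity)]
    have := hN n hn
    rw [div_lt_iff₀ hε] at this
    linarith
  · rw [mul_add, mul_div_cancel₀ _ hb0, add_smul, torusProj_add]
    rw [dist_eq_norm] at hy ⊢
    convert hy using 2
    abel

/-! ### Components, Kronecker sets and transitive points -/

theorem coe_iterate_inducedMap {X : Type*} [TopologicalSpace X] (f : C(X, X)) (n : ℕ)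
    (C : NonemptyCompacts X) : (((inducedMap f)^[n] C : NonemptyCompacts X) : Set X) =
      f^[n] '' (C : Set X) := by
  induction n generalizing C with
  | zero => simp
  | succ n ih =>
    rw [Function.iterate_succ_apply, ih, Function.iterate_succ, image_comp]
    rfl

/-- In a product of a totally disconnected space and a connected space, the components are the
copies of the second factor. -/
theorem nonempty_homeomorph_connectedComponentIn {X L I : Type*} [TopologicalSpace X]
    [TopologicalSpace L] [TopologicalSpace I] [TotallyDisconnectedSpace L] [ConnectedSpace I]
    {C : Set X} (ψ : C ≃ₜ L × I) {x : X} (hx : x ∈ C) :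
    Nonempty (connectedComponentIn C x ≃ₜ I) := by
  let j : I → X := fun s => ψ.symm ((ψ ⟨x, hx⟩).1, s)
  have hj : IsEmbedding j := IsEmbedding.subtypeVal.comp
    (ψ.symm.isEmbedding.comp (isEmbedding_prodMkRight _))
  have hrange : connectedComponentIn C x = range j := by
    rw [connectedComponentIn_eq_image hx]
    apply Subset.antisymm
    · rintro _ ⟨q, hq, rfl⟩
      have : (ψ q).1 = (ψ ⟨x, hx⟩).1 := by
        have hc : Continuous fun q => (ψ q).1 := continuous_fst.comp ψ.continuous
        have := hc.image_connectedComponent_eq_singleton ⟨x, hx⟩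
        exact mem_singleton_iff.1 (this ▸ mem_image_of_mem _ hq)
      exact ⟨(ψ q).2, by simp [j, ← this]⟩
    · rintro _ ⟨s, rfl⟩
      refine mem_image_of_mem _ ?_
      have hc : Continuous fun s => ψ.symm ((ψ ⟨x, hx⟩).1, s) := by fun_prop
      exact (isPreconnected_range hc).subset_connectedComponent ⟨(ψ ⟨x, hx⟩).2, by simp⟩
        (mem_range_self s)
  exact ⟨(Homeomorph.setCongr hrange).trans hj.toHomeomorph.symm⟩

/-- A map whose images under a family of maps approximate every continuous map is injective. -/
theorem injective_of_forall_approx {X : Type*} [MetricSpace X] [Nontrivial X]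
    (F : ℕ → ℝ → X) (h : (ℕ → Bool) → ℝ)
    (hh : ∀ (g : C(ℕ → Bool, X)) (ε : ℝ), 0 < ε → ∃ n, ∀ x, dist (F n (h x)) (g x) < ε) :
    Function.Injective h := by
  intro x y hxy
  ext i
  by_contra hne
  obtain ⟨p, q, hpq⟩ := exists_pair_ne X
  -- The test map separates `x` from `y` by their `i`-th coordinate; one point cannot be within half
  -- of `dist p q` of both values.
  obtain ⟨n, hn⟩ := hh ⟨fun z => if z i = x i then p else q,
    (continuous_of_discreteTopology (f := fun b => if b = x i then p else q)).comp
      (continuous_apply i)⟩ (dist p q / 2) (half_pos (dist_pos.2 hpq))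
  have h1 := hn x
  have h2 := hn y
  simp only [ContinuousMap.coe_mk, if_true, if_neg (Ne.symm hne), ← hxy] at h1 h2
  linarith [dist_triangle_left p q (F n (h x))]

/-- A Cantor family of points on which the iterates of `f` approximate every continuous map is a
Kronecker set. -/
theorem isKroneckerSet_range {X : Type*} [MetricSpace X] (f : C(X, X))
    {e : (ℕ → Bool) → X} (he : IsEmbedding e)
    (h : ∀ (g : C(ℕ → Bool, X)) (ε : ℝ), 0 < ε → ∃ n, ∀ x, dist (f^[n] (e x)) (g x) < ε) :
    IsKroneckerSet f (range e) := by
  have hL := isCantorSet_range he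
  refine ⟨hL, ?_⟩
  have : CompactSpace (range e) := isCompact_iff_compactSpace.1 hL.2.1
  refine Metric.dense_iff.2 fun g ε hε => ?_
  obtain ⟨n, hn⟩ := h (g.comp ⟨he.toHomeomorph, he.toHomeomorph.continuous⟩) (ε / 2) (by positivity)
  refine ⟨_, ?_, mem_range_self n⟩
  refine lt_of_le_of_lt ((ContinuousMap.dist_le (C := ε / 2) (by positivity)).2 ?_)
    (half_lt_self hε)
  rintro ⟨_, x, rfl⟩
  exact (hn x).le

/-- If the iterates of `f` on a Cantor family `e` approximate every continuous map and the iterates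
of `C` shadow those of the family, then `C` is a transitive point of the induced map. -/
theorem isTransitivePoint_inducedMap {X : Type*} [MetricSpace X] (f : C(X, X))
    {e : (ℕ → Bool) → X}
    (h : ∀ (g : C(ℕ → Bool, X)) (ε : ℝ), 0 < ε → ∀ N, ∃ n ≥ N, ∀ x, dist (f^[n] (e x)) (g x) < ε)
    (C : NonemptyCompacts X) (heC : range e ⊆ C)
    (hC : ∀ ε > 0, ∃ N, ∀ n ≥ N, ∀ z ∈ C, ∃ x, dist (f^[n] z) (f^[n] (e x)) < ε) :
    IsTransitivePoint (inducedMap f) C := by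
  refine eq_univ_of_forall fun Y => ?_
  rw [mem_omegaLimit_singleton_iff_mapClusterPt, mapClusterPt_iff_frequently]
  intro s hs
  obtain ⟨ε, hε, hεs⟩ := Metric.mem_nhds_iff.1 hs
  have : Nonempty Y := Y.nonempty.to_subtype
  have : CompactSpace Y := isCompact_iff_compactSpace.1 Y.isCompact
  obtain ⟨g, hg, hgs⟩ := exists_nat_bool_continuous_surjective_of_compact Y
  obtain ⟨N₁, hN₁⟩ := hC (ε / 3) (by positivity)
  refine frequently_atTop.2 fun N => ?_
  obtain ⟨n, hn, hne⟩ := h ⟨fun x => g x, continuous_subtype_val.comp hg⟩ (ε / 3) (by positivity)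
    (max N N₁)
  refine ⟨n, (le_max_left _ _).trans hn, hεs ?_⟩
  rw [Metric.mem_ball, Metric.NonemptyCompacts.dist_eq, coe_iterate_inducedMap]
  refine lt_of_le_of_lt (Metric.hausdorffDist_le_of_mem_dist (r := 2 * ε / 3) (by positivity) ?_ ?_)
    (by linarith)
  · rintro _ ⟨z, hz, rfl⟩
    obtain ⟨x, hx⟩ := hN₁ n ((le_max_right _ _).trans hn) z hz
    refine ⟨g x, (g x).2, ?_⟩
    have : dist (f^[n] (e x)) (g x) < ε / 3 := hne x
    linarith [dist_triangle (f^[n] z) (f^[n] (e x)) (g x)]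
  · intro y hy
    obtain ⟨x, hx⟩ := hgs ⟨y, hy⟩
    refine ⟨_, mem_image_of_mem _ (heC (mem_range_self x)), ?_⟩
    have : dist (f^[n] (e x)) (g x) < ε / 3 := hne x
    rw [hx] at this
    rw [dist_comm]
    linarith

/-! ### Construction of `C` and `L` -/

theorem theorem4p3 (A : Matrix (Fin 2) (Fin 2) ℤ) (hA : IsHyperbolicToral A) :
    ∃ C : NonemptyCompacts (UnitAddTorus (Fin 2)),
      IsTransitivePoint (inducedMap (toralMap A)) C ∧
      ∃ L : Set (UnitAddTorus (Fin 2)),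
        IsCantorSet L ∧
        Nonempty ((C : Set (UnitAddTorus (Fin 2))) ≃ₜ L × Icc (0 : ℝ) 1) ∧
        (∀ x ∈ (C : Set (UnitAddTorus (Fin 2))),
          Nonempty (connectedComponentIn (C : Set (UnitAddTorus (Fin 2))) x ≃ₜ
            Icc (0 : ℝ) 1)) ∧
        IsKroneckerSet (toralMap A) L ∧
        ∃ (v : EuclideanSpace ℝ (Fin 2)) (μ : ℝ) (M : ℝ),
          ‖v‖ = 1 ∧ planeMap A v = μ • v ∧ |μ| < 1 ∧ 0 < M ∧
          ∃ φ : L × Icc (-M) M ≃ₜ (C : Set (UnitAddTorus (Fin 2))),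
            ∀ (a : L) (s : Icc (-M) M),
              ((φ (a, s) : (C : Set (UnitAddTorus (Fin 2)))) : UnitAddTorus (Fin 2)) =
                (a : UnitAddTorus (Fin 2)) + torusProj ((s : ℝ) • v) := by
  obtain ⟨μ, b, hμ, hb, hμroot, hbroot⟩ := hA.exists_eigenvalues
  obtain ⟨v, hv1, hv⟩ := exists_eigenvector A μ hμroot
  obtain ⟨w, hw1, hw⟩ := exists_eigenvector A b hbroot
  have hv0 : v ≠ 0 := fun h => by simp [h] at hv1
  have hw0 : w ≠ 0 := fun h => by simp [h] at hw1
  have hμb : μ ≠ b := by rintro rfl; linarith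
  have hdense : DenseRange fun s : ℝ => torusProj (s • w) := by
    obtain ⟨h0, h1⟩ := irrational_slope (irrational_of_quadratic hA.1 hb hbroot) hw0 hw
    exact denseRange_torusProj_smul h0 h1
  obtain ⟨h, hhr, hh⟩ := exists_forall_approx (K := ℕ → Bool)
    (fun n => (⟨fun c => torusProj ((b ^ n * c) • w),
      continuous_torusProj.comp (by fun_prop)⟩ : C(ℝ, UnitAddTorus (Fin 2))))
    (fun ε hε δ hδ => eventually_expanded_segment_dense hdense hb hε hδ)
    (r := 1 / 5) (by norm_num)
  simp only [ContinuousMap.coe_mk] at hh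
  have : Nontrivial (UnitAddTorus (Fin 2)) := by
    refine ⟨torusProj ((1 / 2 : ℝ) • w), 0, fun hz => ?_⟩
    have := eq_zero_of_torusProj_eq_zero (by rw [norm_smul, hw1]; norm_num) hz
    simp [hw0] at this
  have hinj : Function.Injective h :=
    injective_of_forall_approx (fun n c => torusProj ((b ^ n * c) • w)) h fun g ε hε =>
      (hh g ε hε 0).imp fun n hn => hn.2
  -- With `|h| < 1/5` and `M = 1/5`, two lifted points differ by at most `2/5 + 2/5 < 1`, so `Φ` is
  -- injective.
  let M : ℝ := 1 / 5
  have hM : 0 < M := by norm_num [M]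
  have h0M : (0 : ℝ) ∈ Icc (-M) M := ⟨by linarith, hM.le⟩
  let e : (ℕ → Bool) → UnitAddTorus (Fin 2) := fun x => torusProj (h x • w)
  let Φ : (ℕ → Bool) × Icc (-M) M → UnitAddTorus (Fin 2) :=
    fun p => e p.1 + torusProj ((p.2 : ℝ) • v)
  have hec : Continuous e := continuous_torusProj.comp (by fun_prop)
  have hΦc : Continuous Φ :=
    (hec.comp continuous_fst).add (continuous_torusProj.comp (by fun_prop))
  have hΦi : Function.Injective Φ := by
    rintro ⟨x, s⟩ ⟨y, s'⟩ hxy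
    have hxy' : torusProj ((h x - h y) • w + ((s : ℝ) - s') • v) = 0 := by
      rw [← sub_eq_zero.2 hxy]
      simp only [Φ, e, ← torusProj_add, ← torusProj_sub]
      congr 1
      module
    have hnorm : ‖(h x - h y) • w + ((s : ℝ) - s') • v‖ < 1 := by
      have h1 := abs_lt.1 (hhr x)
      have h2 := abs_lt.1 (hhr y)
      have h3 := s.2
      have h4 := s'.2
      simp only [M, mem_Icc] at h3 h4
      refine (norm_add_le _ _).trans_lt ?_
      rw [norm_smul, norm_smul, hv1, hw1, Real.norm_eq_abs, Real.norm_eq_abs]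
      have h5 : |h x - h y| ≤ 2 / 5 := abs_le.2 ⟨by linarith, by linarith⟩
      have h6 : |(s : ℝ) - s'| ≤ 2 / 5 := abs_le.2 ⟨by linarith, by linarith⟩
      linarith
    obtain ⟨hc, hd⟩ := eigenvectors_independent hμb hv0 hw0 hv hw
      (eq_zero_of_torusProj_eq_zero hnorm hxy')
    exact Prod.ext (hinj (sub_eq_zero.1 hc)) (Subtype.ext (sub_eq_zero.1 hd))
  have hΦ0 (x) : Φ (x, ⟨0, h0M⟩) = e x := by
    simp only [Φ, zero_smul]
    simp [torusProj, funext_iff]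
  have hei : Function.Injective e := fun x y hxy => by
    rw [← hΦ0, ← hΦ0] at hxy
    exact congrArg Prod.fst (hΦi hxy)
  have he : IsEmbedding e := (hec.isClosedEmbedding hei).isEmbedding
  have hΦ : IsEmbedding Φ := (hΦc.isClosedEmbedding hΦi).isEmbedding
  have happrox (g : C(ℕ → Bool, UnitAddTorus (Fin 2))) (ε : ℝ) (hε : 0 < ε) (N : ℕ) :
      ∃ n ≥ N, ∀ x, dist ((toralMap A)^[n] (e x)) (g x) < ε := by
    simpa only [e, iterate_toralMap_torusProj_smul hw] using hh g ε hε N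
  let C : NonemptyCompacts (UnitAddTorus (Fin 2)) :=
    ⟨⟨range Φ, isCompact_range hΦc⟩, ⟨_, mem_range_self (fun _ => false, ⟨0, h0M⟩)⟩⟩
  let φ : range e × Icc (-M) M ≃ₜ (C : Set (UnitAddTorus (Fin 2))) :=
    (he.toHomeomorph.symm.prodCongr (Homeomorph.refl _)).trans hΦ.toHomeomorph
  have hMM : -M < M := by linarith
  let ψ : (C : Set (UnitAddTorus (Fin 2))) ≃ₜ range e × Icc (0 : ℝ) 1 :=
    φ.symm.trans ((Homeomorph.refl _).prodCongr (iccHomeoI (-M) M hMM))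
  have hK := isKroneckerSet_range (toralMap A) he fun g ε hε =>
    (happrox g ε hε 0).imp fun n hn => hn.2
  have : TotallyDisconnectedSpace (range e) :=
    totallyDisconnectedSpace_subtype_iff.2 hK.1.2.2.2
  have : ConnectedSpace (Icc (0 : ℝ) 1) :=
    isConnected_iff_connectedSpace.1 (isConnected_Icc zero_le_one)
  refine ⟨C, isTransitivePoint_inducedMap _ happrox C ?_ ?_, range e, hK.1, ⟨ψ⟩,
    fun x hx => nonempty_homeomorph_connectedComponentIn ψ hx, hK,
    v, μ, M, hv1, hv, hμ, hM, φ, ?_⟩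
  · rintro _ ⟨x, rfl⟩
    exact ⟨_, hΦ0 x⟩
  · intro ε hε
    obtain ⟨N, hN⟩ := eventually_atTop.1
      ((tendsto_pow_atTop_nhds_zero_of_lt_one (abs_nonneg μ) hμ).eventually_lt_const
        (div_pos hε hM))
    refine ⟨N, fun n hn => ?_⟩
    rintro _ ⟨⟨x, s⟩, rfl⟩
    refine ⟨x, ?_⟩
    have hs : |(s : ℝ)| ≤ M := abs_le.2 s.2
    have hlt := hN n hn
    rw [lt_div_iff₀ hM] at hlt
    simp only [Φ]
    rw [iterate_toralMap_add, dist_self_add_left, iterate_toralMap_torusProj_smul hv]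
    refine (norm_torusProj_le _).trans_lt (lt_of_le_of_lt ?_ hlt)
    rw [norm_smul, hv1, mul_one, Real.norm_eq_abs, abs_mul, abs_pow]
    gcongr
  · rintro ⟨_, x, rfl⟩ s
    have : he.toHomeomorph.symm ⟨e x, mem_range_self x⟩ = x :=
      he.toHomeomorph.symm_apply_eq.2 rfl
    change Φ (he.toHomeomorph.symm ⟨e x, mem_range_self x⟩, s) = _
    rw [this]
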